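/- Let $L\ge 1$ be an integer and let $\Lambda$ be the cubic lattice $\mathbb Z^3/L\mathbb Z^3$ in the torus $\mathbb R^3/L\mathbb Z^3$, with its $3L^3$ plaquettes (unit squares). Let $\Gamma$ be the dual lattice: its vertex set $\mathbb V_\Gamma$ is the set of the $L^3$ unit cubes, and its edge set $\mathbb E_\Gamma$ is the set of plaquettes, the edge $e$ joining the two cubes $v_1(e),v_2(e)$ that share the plaquette $e$. Let $\mathbf S$ be the boundary of a regular neighbourhood of $\Lambda$. Cut along the plaquette circles, $\mathbf S$ falls into six-holed spheres, one for each cube, the holes corresponding to the faces of the cube. Decompose each of these spheres, in any way, into four trinions (pairs of pants) by three further circles. This gives a pants decomposition of $\mathbf S$ with $4L^3$ trinions and a set $\tilde\Gamma$ of $6L^3$ circles, which contains the plaquettes. Let $\mathcal P\subset\mathbb R^{\tilde\Gamma}$ be the polytope of those $\mathbf t=(t_\gamma)_{\gamma\in\tilde\Gamma}$ such that for every trinion the coordinates $t_1,t_2,t_3$ at its three boundary circles satisfy $$0\le t_i\le 1\ (i=1,2,3),\qquad t_1+t_2+t_3\le 2,\qquad |t_2-t_3|\le t_1\le t_2+t_3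 .$$ Let $\beta'>0$, let $\hat\chi_l(u)=\sin((l+1)u)/\sin u$ (extended by continuity), and let $$w(t)=\sum_{l=0}^\infty e^{-l(l+1)\beta'^2/2}\,(l+1)\,\hat\chi_l(\pi t)$$ be the Migdal plaquette weight; this series converges for every real $t$. Then the product of the plaquette weights is integrable on $\mathcal P$ for Lebesgue measure $d\mathbf t$, and the symplectic partition function with the Migdal action, $$Z'_{\beta'}=\int_{\mathcal P}\ \prod_{e\in\mathbb E_\Gamma} w(t_e)\ d\mathbf t ,$$ is the sum of the convergent series $$Z'_{\beta'}=\sum_{n:\mathbb V_\Gamma\to\mathbb Z_{\ge 0}}\ \prod_{v\in\mathbb V_\Gamma}\Big(\frac{\sqrt2}{\pi(n_v+1)}\Big)^4\ \prod_{e\in\mathbb E_\Gamma}\Big\{\widetilde{\sum_{l_e=|n_{v_1(e)}-n_{v_2(e)}|}^{n_{v_1(e)}+n_{v_2(e)}}} e^{-l_e(l_e+1)\beta'^2/2}\,(l_e+1)\Big\},$$ all of whose terms are positive. Here $\widetilde{\sum}$ means that $l_e$ runs in steps of $2$ from the lower to the upper limit. -/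

import Mathlib

/-! ### The periodic cubic lattice and its dual

Everything takes place in the torus `ℝ³ / Lℤ³`. -/

/-- Points of `ℤ³ / Lℤ³`, the vertices of the lattice `Λ`. The point `x` also names the unit cube
`x + [0,1]³`, hence its centre, a vertex of the dual lattice `Γ`. -/
abbrev LatticePoint (L : ℕ) : Type := Fin 3 → ZMod L

/-- The plaquettes of `Λ`: `(x, i)` is the unit square with lowest corner `x` spanned by the two
coordinate directions other than `i`. It is the face shared by the cubes `x - eᵢ` and `x`, so the
plaquettes are also the unoriented edges of `Γ`. -/
abbrev Plaquette (L : ℕ) : Type := LatticePoint L × Fin 3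

/-- The first end `v₁(e)` of the edge of `Γ` dual to a plaquette. -/
def Plaquette.v₁ {L : ℕ} (e : Plaquette L) : LatticePoint L := e.1 - Pi.single e.2 1

/-- The second end `v₂(e)` of the edge of `Γ` dual to a plaquette. -/
def Plaquette.v₂ {L : ℕ} (e : Plaquette L) : LatticePoint L := e.1

/-- The six faces of the unit cube: `(i, false)` is the face `{yᵢ = 0}`, `(i, true)` the face
`{yᵢ = 1}`. -/
abbrev CubeFace : Type := Fin 3 × Bool

/-- The plaquette which is the face `f` of the cube `x`. -/
def facePlaquette {L : ℕ} (x : LatticePoint L) (f : CubeFace) : Plaquette L :=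
  (if f.2 then x + Pi.single f.1 1 else x, f.1)

/-! ### Pants decompositions -/

/-- (The combinatorial type of) a pants decomposition of the sphere with six holes around the
centre of a cube, the holes being labelled by the faces of the cube: four trinions, each with three
boundary circles. A boundary circle is either one of the six hole circles, each occurring once, or
one of three added circles, each of which is shared by two boundary components. The four trinions
glued along the added circles form a connected surface (which has Euler characteristic `-4` and six
boundary circles, and therefore is a six-holed sphere). -/
structure SixHoledSpherePants where
  /-- the circle forming the `j`-th boundary component of the `p`-th trinion -/
  circle : Fin 4 → Fin 3 → CubeFace ⊕ Fin 3
  face_once : ∀ f : CubeFace,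
    (Finset.univ.filter fun q : Fin 4 × Fin 3 => circle q.1 q.2 = Sum.inl f).card = 1
  added_twice : ∀ c : Fin 3,
    (Finset.univ.filter fun q : Fin 4 × Fin 3 => circle q.1 q.2 = Sum.inr c).card = 2
  connected : (SimpleGraph.fromRel fun p p' : Fin 4 =>
    ∃ c j j', circle p j = Sum.inr c ∧ circle p' j' = Sum.inr c).Connected

/-- The circles of the pants decomposition of the surface `S_Λ`: the (lifted) plaquettes, and three
further circles for each cube. These are the edges of the trinion graph. -/
abbrev PantsCircle (L : ℕ) : Type := Plaquette L ⊕ (LatticePoint L × Fin 3)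

/-- The trinions of the pants decomposition of `S_Λ`: four for each cube. These are the vertices
of the trinion graph. -/
abbrev Trinion (L : ℕ) : Type := LatticePoint L × Fin 4

/-- The three boundary circles of a trinion, in the pants decomposition of `S_Λ` obtained by
cutting `S_Λ` along the plaquettes into six-holed spheres, one for each cube `x`, and decomposing
the latter according to `D x`. -/
def boundaryCircle {L : ℕ} (D : LatticePoint L → SixHoledSpherePants) (p : Trinion L) (j : Fin 3) :
    PantsCircle L :=
  match (D p.1).circle p.2 j with
  | Sum.inl f => Sum.inl (facePlaquette p.1 f)
  | Sum.inr c => Sum.inr (p.1, c)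

/-- The trinion polytope in `ℝ³`, given by the spherical triangle inequalities. -/
def trinionPolytope : Set (Fin 3 → ℝ) :=
  {t | (∀ i, 0 ≤ t i ∧ t i ≤ 1) ∧ t 0 + t 1 + t 2 ≤ 2 ∧ |t 1 - t 2| ≤ t 0 ∧ t 0 ≤ t 1 + t 2}

/-- The polytope of the pants decomposition: the three coordinates at each trinion satisfy the
spherical triangle inequalities. -/
def pantsPolytope {L : ℕ} (D : LatticePoint L → SixHoledSpherePants) : Set (PantsCircle L → ℝ) :=
  {t | ∀ p : Trinion L, (fun j => t (boundaryCircle D p j)) ∈ trinionPolytope}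

/-! ### The Migdal weight -/

/-- The character `χ̂_l(u) = sin((l+1)u) / sin u` of the `(l+1)`-dimensional irreducible
representation of `SU(2)` at an element of trace `2 cos u` (with its continuous extension to the
zeros of `sin`), written as a Chebyshev polynomial of the second kind in `cos u`. -/
noncomputable def charHat (l : ℕ) (u : ℝ) : ℝ :=
  (Polynomial.Chebyshev.U ℝ (l : ℤ)).eval (Real.cos u)

theorem charHat_eq_div (l : ℕ) (u : ℝ) (hu : Real.sin u ≠ 0) :
    charHat l u = Real.sin ((l + 1) * u) / Real.sin u := by
  rw [eq_div_iff hu]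
  simp [charHat]

/-- The coefficient `exp(-l(l+1)β²/2) (l+1)`. -/
noncomputable def migdalCoeff (β : ℝ) (l : ℕ) : ℝ :=
  Real.exp (-((l : ℝ) * (l + 1) * β ^ 2 / 2)) * (l + 1)

/-- The Migdal weight of a plaquette whose holonomy has trace `2 cos (π t)`. -/
noncomputable def migdalWeight (β : ℝ) (t : ℝ) : ℝ :=
  ∑' l : ℕ, migdalCoeff β l * charHat l (Real.pi * t)

/-- The product of the Migdal weights of all plaquettes. -/
noncomputable def migdalWeightProd {L : ℕ} [NeZero L] (β : ℝ) (t : PantsCircle L → ℝ) : ℝ :=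
  ∏ e : Plaquette L, migdalWeight β (t (Sum.inl e))

/-- The symplectic partition function with the Migdal action: the integral, with respect to
Lebesgue measure, of the product of the Migdal weights over the polytope of the pants
decomposition. -/
noncomputable def symplecticPartitionMigdal {L : ℕ} [NeZero L]
    (D : LatticePoint L → SixHoledSpherePants) (β : ℝ) : ℝ :=
  ∫ t in pantsPolytope D, migdalWeightProd β t

/-! ### The series -/

/-- The sum `f a + f (a+2) + f (a+4) + ⋯`, over indices up to `b`. -/
def altSum (a b : ℕ) (f : ℕ → ℝ) : ℝ :=
  ∑ l ∈ (Finset.Icc a b).filter (fun l => Even (l - a)), f l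

/-- The contribution of an edge of `Γ` whose ends carry the indices `n`, `m`. -/
noncomputable def migdalEdgeFactor (β : ℝ) (n m : ℕ) : ℝ :=
  altSum ((n : ℤ) - (m : ℤ)).natAbs (n + m) (migdalCoeff β)

/-- The term of the series at the indices `n_v`, for `v` ranging over the vertices of `Γ`. -/
noncomputable def migdalTerm {L : ℕ} [NeZero L] (β : ℝ) (n : LatticePoint L → ℕ) : ℝ :=
  (∏ v : LatticePoint L, (Real.sqrt 2 / (Real.pi * ((n v : ℝ) + 1))) ^ 4) *
    ∏ e : Plaquette L, migdalEdgeFactor β (n e.v₁) (n e.v₂)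

/-! Almost everywhere on the unit cube the indicator of the trinion polytope is `∑ 4/(π(n+1)) ∏ⱼ
sin((n+1)πtⱼ)`. Writing each product of three sines as a combination of four sines turns this into a
combination of four sawtooth series `∑ sin(kx)/k`, whose jumps lie on the walls of the polytope
(`trinionSum_eq`, `tendsto_trinionSum`).

The indicator of the whole polytope is the product of these indicators over all trinions. Truncating
each expansion at `N` and multiplying out gives a finite sum over indices `m p`, one per trinion,
which is integrated circle by circle. At an added circle two sines meet, and orthogonality kills the
term unless the two trinions have the same index; since the four trinions of a cube are connected,
only an index `n x` per cube survives (`modeIntegral_eq_zero`). At a plaquette the integral of the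
weight against the sines of the two neighbouring cubes is half the edge factor, by Clebsch–Gordan
(`modeIntegral_comp_fst`). So the truncated integral is exactly the sum of `migdalTerm` over a box
(`integral_prod_trinionSum`).

Partial sums of the sawtooth series are uniformly bounded (`abs_sawSum_le`), so dominated
convergence sends the truncated integrals to the partition function. All terms are positive, so
convergence over boxes is summability. -/

/-! ### The Fourier series of the sawtooth function -/

/-- The partial sums of the series `∑ sin (n x) / n`. -/
noncomputable def sawSum (N : ℕ) (x : ℝ) : ℝ :=
  ∑ n ∈ Finset.range N, Real.sin (((n : ℝ) + 1) * x) / ((n : ℝ) + 1)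

theorem im_exp_mul_I_pow (x : ℝ) (n : ℕ) :
    ((Complex.exp (x * Complex.I)) ^ n).im = Real.sin (n * x) := by
  rw [← Complex.exp_nat_mul, ← mul_assoc, ← Complex.ofReal_natCast, ← Complex.ofReal_mul,
    Complex.exp_ofReal_mul_I_im]

theorem hasSum_pow_succ_div_neg_log {z : ℂ} (hz : ‖z‖ < 1) :
    HasSum (fun n : ℕ => z ^ (n + 1) / ((n : ℂ) + 1)) (-Complex.log (1 - z)) := by
  have h := (hasSum_nat_add_iff' 1).2 (Complex.hasSum_taylorSeries_neg_log hz)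
  simpa using h

theorem hasSum_abel_sin (x : ℝ) {r : ℝ} (h0 : 0 ≤ r) (h1 : r < 1) :
    HasSum (fun n : ℕ => r ^ (n + 1) * (Real.sin (((n : ℝ) + 1) * x) / ((n : ℝ) + 1)))
      (-(1 - r * Complex.exp (x * Complex.I)).arg) := by
  have hz : ‖(r : ℂ) * Complex.exp (x * Complex.I)‖ < 1 := by
    rw [norm_mul, Complex.norm_exp_ofReal_mul_I]
    simpa [abs_of_nonneg h0] using h1
  have h := Complex.hasSum_im (hasSum_pow_succ_div_neg_log hz)
  rw [Complex.neg_im, Complex.log_im] at h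
  convert! h using 2 with n
  have e : (n : ℂ) + 1 = ((n + 1 : ℕ) : ℂ) := by push_cast; rfl
  rw [mul_pow, ← Complex.ofReal_pow, e, Complex.div_natCast_im,
    Complex.im_ofReal_mul, im_exp_mul_I_pow, Nat.cast_add_one, mul_div_assoc]

theorem abs_arg_one_sub_le (x : ℝ) {r : ℝ} (h0 : 0 ≤ r) (h1 : r < 1) :
    |(1 - r * Complex.exp (x * Complex.I)).arg| ≤ Real.pi / 2 := by
  rw [Complex.abs_arg_le_pi_div_two_iff]
  have : r * Real.cos x ≤ r * 1 := mul_le_mul_of_nonneg_left (Real.cos_le_one x) h0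
  simp [Complex.exp_ofReal_mul_I_re]
  linarith

/-- Comparison with the Abel mean at radius `r = 1 - 1/(N+1)`. The mean is minus the argument of a
number with nonnegative real part, hence at most `π/2` in size; its tail and the error in the first
`N` terms each cost at most `1`. This supplies the dominating function. -/
theorem abs_sawSum_le (N : ℕ) (x : ℝ) : |sawSum N x| ≤ Real.pi / 2 + 2 := by
  set a : ℕ → ℝ := fun n => Real.sin (((n : ℝ) + 1) * x) / ((n : ℝ) + 1) with ha
  have ha' : ∀ n, |a n| ≤ 1 / ((n : ℝ) + 1) := by
    intro n
    have hn : (0 : ℝ) < (n : ℝ) + 1 := by positivity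
    rw [ha, abs_div, abs_of_pos hn]
    gcongr
    exact Real.abs_sin_le_one _
  have hN : (0 : ℝ) < (N : ℝ) + 1 := by positivity
  set r : ℝ := 1 - 1 / ((N : ℝ) + 1) with hr
  have hd : 1 / ((N : ℝ) + 1) ≤ 1 := by
    rw [div_le_one hN]; linarith [Nat.cast_nonneg (α := ℝ) N]
  have h0 : 0 ≤ r := by linarith
  have hdpos : 0 < 1 / ((N : ℝ) + 1) := by positivity
  have h1 : r < 1 := by linarith
  have hs := hasSum_abel_sin x h0 h1
  have hb := abs_arg_one_sub_le x h0 h1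
  have htail := (hasSum_nat_add_iff' N).2 hs
  have hgeo : HasSum (fun n : ℕ => 1 / ((N : ℝ) + 1) * r ^ n) (1 / ((N : ℝ) + 1) * (1 - r)⁻¹) :=
    (hasSum_geometric_of_lt_one h0 h1).mul_left _
  have hgeo1 : 1 / ((N : ℝ) + 1) * (1 - r)⁻¹ = 1 := by
    rw [hr, sub_sub_cancel, mul_inv_cancel₀ hdpos.ne']
  rw [hgeo1] at hgeo
  have ht : |-(1 - r * Complex.exp (x * Complex.I)).arg
      - ∑ n ∈ Finset.range N, r ^ (n + 1) * a n| ≤ 1 := by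
    rw [← Real.norm_eq_abs]
    refine htail.norm_le_of_bounded hgeo fun n => ?_
    rw [Real.norm_eq_abs, abs_mul, abs_of_nonneg (pow_nonneg h0 _), mul_comm]
    refine mul_le_mul ((ha' (n + N)).trans ?_) ?_ (pow_nonneg h0 _) hdpos.le
    · push_cast
      gcongr
      linarith [Nat.cast_nonneg (α := ℝ) n]
    · exact pow_le_pow_of_le_one h0 h1.le (by omega)
  have hpart : |sawSum N x - ∑ n ∈ Finset.range N, r ^ (n + 1) * a n| ≤ 1 := by
    have : sawSum N x - ∑ n ∈ Finset.range N, r ^ (n + 1) * a n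
        = ∑ n ∈ Finset.range N, (1 - r ^ (n + 1)) * a n := by
      rw [sawSum, ← Finset.sum_sub_distrib]
      exact Finset.sum_congr rfl fun n _ => by ring
    rw [this]
    calc _ ≤ ∑ n ∈ Finset.range N, |(1 - r ^ (n + 1)) * a n| := Finset.abs_sum_le_sum_abs _ _
      _ ≤ ∑ n ∈ Finset.range N, 1 / ((N : ℝ) + 1) := by
        refine Finset.sum_le_sum fun n _ => ?_
        have hn : (0 : ℝ) < (n : ℝ) + 1 := by positivity
        -- Bernoulli: `1 - r^(n+1) ≤ (n+1)/(N+1)`, which cancels the denominator of `a n`.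
        have hbern := one_add_mul_le_pow (a := -(1 / ((N : ℝ) + 1))) (by linarith) (n + 1)
        have e : 1 + -(1 / ((N : ℝ) + 1)) = r := by rw [hr]; ring
        rw [e] at hbern
        push_cast at hbern
        have hle : r ^ (n + 1) ≤ 1 := pow_le_one₀ h0 h1.le
        rw [abs_mul, abs_of_nonneg (by linarith)]
        calc _ ≤ (((n : ℝ) + 1) * (1 / ((N : ℝ) + 1))) * (1 / ((n : ℝ) + 1)) :=
              mul_le_mul (by linarith) (ha' n) (abs_nonneg _) (by positivity)
          _ = _ := by field_simp
      _ ≤ 1 := by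
        rw [Finset.sum_const, Finset.card_range, nsmul_eq_mul, mul_one_div, div_le_one hN]
        linarith
  rw [abs_le] at *
  constructor <;> linarith [hb.1, hb.2, ht.1, ht.2, hpart.1, hpart.2]

/-- Polar form: `1 - e^{ix} = 2 sin(x/2) e^{i(x-π)/2}`, with positive modulus on this range. -/
theorem arg_one_sub_exp {x : ℝ} (h0 : 0 < x) (h1 : x < 2 * Real.pi) :
    (1 - Complex.exp (x * Complex.I)).arg = (x - Real.pi) / 2 := by
  have hs : 0 < 2 * Real.sin (x / 2) :=
    mul_pos two_pos (Real.sin_pos_of_pos_of_lt_pi (by linarith) (by linarith))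
  have hpi := Real.pi_pos
  have hθ : (x - Real.pi) / 2 ∈ Set.Ioc (-Real.pi) Real.pi := ⟨by linarith, by linarith⟩
  rw [← Complex.arg_mul_cos_add_sin_mul_I hs hθ]
  congr 1
  have e1 : Real.cos ((x - Real.pi) / 2) = Real.sin (x / 2) := by
    rw [sub_div, Real.cos_sub_pi_div_two]
  have e2 : Real.sin ((x - Real.pi) / 2) = - Real.cos (x / 2) := by
    rw [sub_div, Real.sin_sub_pi_div_two]
  have e3 : Real.cos x = 1 - 2 * Real.sin (x / 2) ^ 2 := by
    have := Real.cos_two_mul (x / 2)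
    rw [mul_div_cancel₀ x two_ne_zero] at this
    rw [this, Real.cos_sq']; ring
  have e4 : Real.sin x = 2 * Real.sin (x / 2) * Real.cos (x / 2) := by
    have := Real.sin_two_mul (x / 2)
    rwa [mul_div_cancel₀ x two_ne_zero] at this
  rw [← Complex.ofReal_cos, ← Complex.ofReal_sin, e1, e2]
  apply Complex.ext
  · rw [Complex.sub_re, Complex.exp_ofReal_mul_I_re, e3]
    simp [-Complex.ofReal_sin, -Complex.ofReal_cos]
    ring
  · rw [Complex.sub_im, Complex.exp_ofReal_mul_I_im, e4]
    simp [-Complex.ofReal_sin, -Complex.ofReal_cos]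

/-- Dirichlet's test gives convergence on the unit circle, the geometric sums being bounded away
from `z = 1`; Abel's limit theorem then identifies the limit. -/
theorem tendsto_sum_pow_succ_div {z : ℂ} (hz : ‖z‖ = 1) (hs : 1 - z ∈ Complex.slitPlane) :
    Filter.Tendsto (fun N : ℕ => ∑ n ∈ Finset.range N, z ^ (n + 1) / ((n : ℂ) + 1)) Filter.atTop
      (nhds (-Complex.log (1 - z))) := by
  have hz1 : z - 1 ≠ 0 := by
    intro h
    have : 1 - z = 0 := by rw [← neg_sub, h, neg_zero]
    rw [this] at hs
    exact Complex.slitPlane_ne_zero hs rfl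
  have hc : CauchySeq fun N : ℕ => ∑ n ∈ Finset.range N, z ^ (n + 1) / ((n : ℂ) + 1) := by
    have hanti : Antitone fun n : ℕ => 1 / ((n : ℝ) + 1) := by
      intro m n hmn
      have : (m : ℝ) ≤ n := by exact_mod_cast hmn
      dsimp only
      gcongr
    have := hanti.cauchySeq_series_mul_of_tendsto_zero_of_bounded
      tendsto_one_div_add_atTop_nhds_zero_nat (z := fun n => z ^ (n + 1)) (b := 2 / ‖z - 1‖) ?_
    · convert! this using 2 with N
      refine Finset.sum_congr rfl fun n _ => ?_
      rw [Complex.real_smul]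
      push_cast
      ring
    · intro n
      have e : ∑ i ∈ Finset.range n, z ^ (i + 1) = z * ((z ^ n - 1) / (z - 1)) := by
        rw [← geom_sum_eq (sub_ne_zero.1 hz1), Finset.mul_sum]
        exact Finset.sum_congr rfl fun i _ => by ring
      rw [e, norm_mul, hz, one_mul, norm_div]
      gcongr
      calc _ ≤ ‖z ^ n‖ + ‖(1 : ℂ)‖ := norm_sub_le _ _
        _ = 2 := by rw [norm_pow, hz, one_pow, norm_one]; norm_num
  obtain ⟨l, hl⟩ := cauchySeq_tendsto_of_complete hc
  have habel := Complex.tendsto_tsum_powerSeries_nhdsWithin_lt hl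
  rw [Filter.tendsto_map'_iff] at habel
  have hid : Filter.Tendsto (fun r : ℝ => (r : ℂ)) (nhdsWithin 1 (Set.Iio 1)) (nhds 1) := by
    have : Filter.Tendsto (fun r : ℝ => (r : ℂ)) (nhds 1) (nhds ((1 : ℝ) : ℂ)) :=
      Complex.continuous_ofReal.tendsto 1
    rw [Complex.ofReal_one] at this
    exact this.mono_left nhdsWithin_le_nhds
  -- The extra factor `r` turns `r^n z^(n+1)` into `(rz)^(n+1)`.
  have h1 := hid.mul habel
  rw [one_mul] at h1
  have h2 : Filter.Tendsto (fun r : ℝ => -Complex.log (1 - r * z)) (nhdsWithin 1 (Set.Iio 1))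
      (nhds (-Complex.log (1 - z))) := by
    refine Filter.Tendsto.neg (Filter.Tendsto.clog ?_ hs)
    have := hid.mul_const z
    rw [one_mul] at this
    exact tendsto_const_nhds.sub this
  have heq : l = -Complex.log (1 - z) := by
    refine tendsto_nhds_unique h1 (h2.congr' ?_)
    filter_upwards [Ioo_mem_nhdsLT (zero_lt_one (α := ℝ))] with r hr
    have hrz : ‖(r : ℂ) * z‖ < 1 := by
      rw [norm_mul, hz, mul_one, Complex.norm_real, Real.norm_eq_abs, abs_of_pos hr.1]
      exact hr.2
    rw [← (hasSum_pow_succ_div_neg_log hrz).tsum_eq, Function.comp_apply, ← tsum_mul_left]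
    exact tsum_congr fun n => by rw [mul_pow]; ring
  exact heq ▸ hl

theorem tendsto_sawSum {x : ℝ} (h0 : 0 < x) (h1 : x < 2 * Real.pi) :
    Filter.Tendsto (fun N => sawSum N x) Filter.atTop (nhds ((Real.pi - x) / 2)) := by
  have hs : 1 - Complex.exp (x * Complex.I) ∈ Complex.slitPlane := by
    rw [Complex.mem_slitPlane_iff_arg]
    have harg := arg_one_sub_exp h0 h1
    have hpi := Real.pi_pos
    constructor
    · rw [harg]; intro h; linarith
    · intro h
      have hc : Real.cos x = 1 := by
        have := congrArg Complex.re h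
        rw [Complex.sub_re, Complex.exp_ofReal_mul_I_re] at this
        simp at this
        linarith
      have := (Real.cos_eq_one_iff_of_lt_of_lt (by linarith) h1).1 hc
      linarith
  have h := (Complex.continuous_im.tendsto _).comp
    (tendsto_sum_pow_succ_div (Complex.norm_exp_ofReal_mul_I x) hs)
  rw [Complex.neg_im, Complex.log_im, arg_one_sub_exp h0 h1] at h
  have e : -((x - Real.pi) / 2) = (Real.pi - x) / 2 := by ring
  rw [e] at h
  refine h.congr fun N => ?_
  rw [Function.comp_apply, Complex.im_sum, sawSum]
  refine Finset.sum_congr rfl fun n _ => ?_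
  have e : (n : ℂ) + 1 = ((n + 1 : ℕ) : ℂ) := by push_cast; rfl
  rw [e, Complex.div_natCast_im, im_exp_mul_I_pow, Nat.cast_add_one]

theorem sawSum_neg (N : ℕ) (x : ℝ) : sawSum N (-x) = -sawSum N x := by
  rw [sawSum, sawSum, ← Finset.sum_neg_distrib]
  exact Finset.sum_congr rfl fun n _ => by rw [mul_neg, Real.sin_neg, neg_div]

theorem sawSum_add_two_pi (N : ℕ) (x : ℝ) : sawSum N (x + 2 * Real.pi) = sawSum N x := by
  refine Finset.sum_congr rfl fun n _ => ?_
  have : ((n : ℝ) + 1) * (x + 2 * Real.pi) = ((n : ℝ) + 1) * x + (n + 1 : ℕ) * (2 * Real.pi) := by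
    push_cast; ring
  rw [this, Real.sin_add_nat_mul_two_pi]

/-! ### The Fourier series of the indicator function of the trinion polytope -/

/-- The partial sums of the expansion of the indicator function of the trinion polytope. -/
noncomputable def trinionSum (N : ℕ) (t : Fin 3 → ℝ) : ℝ :=
  ∑ n ∈ Finset.range N, 4 / (Real.pi * ((n : ℝ) + 1)) *
    ∏ j, Real.sin (((n : ℝ) + 1) * (Real.pi * t j))

theorem four_mul_sin_mul_sin_mul_sin (a b c : ℝ) :
    4 * (Real.sin a * Real.sin b * Real.sin c) = Real.sin (a + b - c) + Real.sin (b + c - a)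
      + Real.sin (c + a - b) - Real.sin (a + b + c) := by
  simp only [Real.sin_add, Real.sin_sub, Real.cos_add]
  ring

theorem trinionSum_eq (N : ℕ) (t : Fin 3 → ℝ) :
    trinionSum N t = (sawSum N (Real.pi * (t 0 + t 1 - t 2)) + sawSum N (Real.pi * (t 1 + t 2 - t 0))
      + sawSum N (Real.pi * (t 2 + t 0 - t 1)) - sawSum N (Real.pi * (t 0 + t 1 + t 2)))
        / Real.pi := by
  simp only [trinionSum, sawSum, ← Finset.sum_add_distrib, ← Finset.sum_sub_distrib,
    Finset.sum_div]
  refine Finset.sum_congr rfl fun n _ => ?_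
  have hn : (n : ℝ) + 1 ≠ 0 := by positivity
  have hpi := Real.pi_ne_zero
  have h := four_mul_sin_mul_sin_mul_sin (((n : ℝ) + 1) * (Real.pi * t 0))
    (((n : ℝ) + 1) * (Real.pi * t 1)) (((n : ℝ) + 1) * (Real.pi * t 2))
  simp only [← mul_add, ← mul_sub] at h
  rw [Fin.prod_univ_three, ← add_div, ← add_div, ← sub_div, ← h]
  field_simp

theorem abs_trinionSum_le (N : ℕ) (t : Fin 3 → ℝ) :
    |trinionSum N t| ≤ 4 * (Real.pi / 2 + 2) / Real.pi := by
  rw [trinionSum_eq, abs_div, abs_of_pos Real.pi_pos]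
  have h1 := abs_le.1 (abs_sawSum_le N (Real.pi * (t 0 + t 1 - t 2)))
  have h2 := abs_le.1 (abs_sawSum_le N (Real.pi * (t 1 + t 2 - t 0)))
  have h3 := abs_le.1 (abs_sawSum_le N (Real.pi * (t 2 + t 0 - t 1)))
  have h4 := abs_le.1 (abs_sawSum_le N (Real.pi * (t 0 + t 1 + t 2)))
  have hpi := Real.pi_pos
  gcongr
  rw [abs_le]
  constructor <;> linarith [h1.1, h1.2, h2.1, h2.2, h3.1, h3.2, h4.1, h4.2]

theorem measurable_trinionSum (N : ℕ) : Measurable (trinionSum N) := by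
  unfold trinionSum
  fun_prop

theorem tendsto_sawSum_pi_mul {x : ℝ} (h0 : 0 < x) (h1 : x < 2) :
    Filter.Tendsto (fun N => sawSum N (Real.pi * x)) Filter.atTop
      (nhds (Real.pi * ((1 - x) / 2))) := by
  have hpi := Real.pi_pos
  have h := tendsto_sawSum (x := Real.pi * x) (by positivity) (by nlinarith)
  convert! h using 2
  ring

theorem tendsto_sawSum_pi_mul_of_neg {x : ℝ} (h0 : -2 < x) (h1 : x < 0) :
    Filter.Tendsto (fun N => sawSum N (Real.pi * x)) Filter.atTop
      (nhds (Real.pi * ((-1 - x) / 2))) := by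
  have h := (tendsto_sawSum_pi_mul (x := -x) (by linarith) (by linarith)).neg
  refine (h.congr fun N => ?_).trans_eq ?_
  · rw [mul_neg, sawSum_neg, neg_neg]
  · congr 1; ring

theorem tendsto_sawSum_pi_mul_of_two_lt {x : ℝ} (h0 : 2 < x) (h1 : x < 4) :
    Filter.Tendsto (fun N => sawSum N (Real.pi * x)) Filter.atTop
      (nhds (Real.pi * ((3 - x) / 2))) := by
  have h := tendsto_sawSum_pi_mul (x := x - 2) (by linarith) (by linarith)
  refine (h.congr fun N => ?_).trans_eq ?_
  · rw [← sawSum_add_two_pi]; congr 1; ring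
  · congr 1; ring

/-- The signs of the four linear forms that occur in the expansion of a product of three sines. -/
def trinionSign (k : Fin 4) (j : Fin 3) : ℤ := if k = j.castSucc then -1 else 1

/-- Away from a null set, the expansion of the indicator function of the trinion polytope
converges. -/
theorem tendsto_trinionSum {t : Fin 3 → ℝ} (ht : ∀ j, t j ∈ Set.Icc (0 : ℝ) 1)
    (hgen : ∀ k : Fin 4, ∀ i ∈ ({0, 2} : Set ℝ), ∑ j, (trinionSign k j : ℝ) * t j ≠ i) :
    Filter.Tendsto (fun N => trinionSum N t) Filter.atTop
      (nhds (trinionPolytope.indicator (fun _ => 1) t)) := by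
  have ha := ht 0
  have hb := ht 1
  have hc := ht 2
  have g0 := hgen 0 0 (by simp)
  have g1 := hgen 1 0 (by simp)
  have g2 := hgen 2 0 (by simp)
  have g3 := hgen 3 0 (by simp)
  have k0 := hgen 0 2 (by simp)
  have k1 := hgen 1 2 (by simp)
  have k2 := hgen 2 2 (by simp)
  have k3 := hgen 3 2 (by simp)
  clear hgen
  simp [Fin.sum_univ_three, trinionSign, Fin.ext_iff] at g0 g1 g2 g3 k0 k1 k2 k3
  obtain ⟨a, hta⟩ : ∃ a, a = t 0 := ⟨_, rfl⟩
  obtain ⟨b, htb⟩ : ∃ b, b = t 1 := ⟨_, rfl⟩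
  obtain ⟨c, htc⟩ : ∃ c, c = t 2 := ⟨_, rfl⟩
  have hmem : t ∈ trinionPolytope ↔
      0 ≤ b + c - a ∧ 0 ≤ c + a - b ∧ 0 ≤ a + b - c ∧ a + b + c ≤ 2 := by
    simp only [trinionPolytope, Set.mem_ofPred_eq, abs_le, ← hta, ← htb, ← htc]
    constructor
    · rintro ⟨-, h1, ⟨h2, h3⟩, h4⟩
      refine ⟨?_, ?_, ?_, ?_⟩ <;> linarith
    · rintro ⟨h1, h2, h3, h4⟩
      exact ⟨ht, by linarith, ⟨by linarith, by linarith⟩, by linarith⟩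
  rw [← hta, ← htb, ← htc] at g0 g1 g2 g3 k0 k1 k2 k3
  rw [← hta] at ha
  rw [← htb] at hb
  rw [← htc] at hc
  obtain ⟨ha0, ha1⟩ := ha
  obtain ⟨hb0, hb1⟩ := hb
  obtain ⟨hc0, hc1⟩ := hc
  have key : ∀ {u v w s : ℝ},
      Filter.Tendsto (fun N => sawSum N (Real.pi * (a + b - c))) Filter.atTop
        (nhds (Real.pi * u)) →
      Filter.Tendsto (fun N => sawSum N (Real.pi * (b + c - a))) Filter.atTop
        (nhds (Real.pi * v)) →
      Filter.Tendsto (fun N => sawSum N (Real.pi * (c + a - b))) Filter.atTop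
        (nhds (Real.pi * w)) →
      Filter.Tendsto (fun N => sawSum N (Real.pi * (a + b + c))) Filter.atTop
        (nhds (Real.pi * s)) →
      Filter.Tendsto (fun N => trinionSum N t) Filter.atTop (nhds (u + v + w - s)) := by
    intro u v w s h1 h2 h3 h4
    refine (((((h1.add h2).add h3).sub h4).div_const Real.pi).congr fun N => ?_).trans_eq ?_
    · rw [trinionSum_eq, hta, htb, htc]
    · congr 1
      field_simp [Real.pi_ne_zero]
  -- Genericity makes the bounds strict, so each form lies inside one period of the sawtooth, where
  -- the limit is affine.
  have lt0 : a + b - c < 2 := lt_of_le_of_ne (by linarith) (fun h => k2 (by linarith))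
  have lt1 : b + c - a < 2 := lt_of_le_of_ne (by linarith) (fun h => k0 (by linarith))
  have lt2 : c + a - b < 2 := lt_of_le_of_ne (by linarith) (fun h => k1 (by linarith))
  have pos : 0 < a + b + c := lt_of_le_of_ne (by linarith) (fun h => g3 (by linarith))
  have ne0 : a + b - c ≠ 0 := fun h => g2 (by linarith)
  have ne1 : b + c - a ≠ 0 := fun h => g0 (by linarith)
  have ne2 : c + a - b ≠ 0 := fun h => g1 (by linarith)
  have ne3 : a + b + c ≠ 2 := fun h => k3 (by linarith)
  clear g0 g1 g2 g3 k0 k1 k2 k3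
  -- At most one of the four inequalities can fail: two of the first three forms add up to twice a
  -- coordinate, and `a + b < c` forces `a + b + c < 2`. If none fails, the affine limits add up to
  -- `1`; a failure moves one form to the next period and lowers the total by `1`.
  rcases lt_or_gt_of_ne ne0 with h0 | h0
  · rw [Set.indicator_of_notMem (by rw [hmem]; intro h; linarith [h.2.2.1])]
    refine (key (tendsto_sawSum_pi_mul_of_neg (by linarith) h0)
      (tendsto_sawSum_pi_mul (by linarith) lt1) (tendsto_sawSum_pi_mul (by linarith) lt2)
      (tendsto_sawSum_pi_mul pos (by linarith))).trans_eq ?_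
    congr 1; ring
  rcases lt_or_gt_of_ne ne1 with h1 | h1
  · rw [Set.indicator_of_notMem (by rw [hmem]; intro h; linarith [h.1])]
    refine (key (tendsto_sawSum_pi_mul h0 lt0) (tendsto_sawSum_pi_mul_of_neg (by linarith) h1)
      (tendsto_sawSum_pi_mul (by linarith) lt2)
      (tendsto_sawSum_pi_mul pos (by linarith))).trans_eq ?_
    congr 1; ring
  rcases lt_or_gt_of_ne ne2 with h2 | h2
  · rw [Set.indicator_of_notMem (by rw [hmem]; intro h; linarith [h.2.1])]
    refine (key (tendsto_sawSum_pi_mul h0 lt0) (tendsto_sawSum_pi_mul h1 lt1)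
      (tendsto_sawSum_pi_mul_of_neg (by linarith) h2)
      (tendsto_sawSum_pi_mul pos (by linarith))).trans_eq ?_
    congr 1; ring
  rcases lt_or_gt_of_ne ne3 with h3 | h3
  · rw [Set.indicator_of_mem (hmem.2 ⟨h1.le, h2.le, h0.le, h3.le⟩)]
    refine (key (tendsto_sawSum_pi_mul h0 lt0) (tendsto_sawSum_pi_mul h1 lt1)
      (tendsto_sawSum_pi_mul h2 lt2) (tendsto_sawSum_pi_mul pos h3)).trans_eq ?_
    congr 1; ring
  · rw [Set.indicator_of_notMem (by rw [hmem]; intro h; linarith [h.2.2.2])]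
    refine (key (tendsto_sawSum_pi_mul h0 lt0) (tendsto_sawSum_pi_mul h1 lt1)
      (tendsto_sawSum_pi_mul h2 lt2)
      (tendsto_sawSum_pi_mul_of_two_lt h3 (by linarith))).trans_eq ?_
    congr 1; ring

theorem isClosed_trinionPolytope : IsClosed trinionPolytope := by
  have h : trinionPolytope = (⋂ i, {t : Fin 3 → ℝ | 0 ≤ t i} ∩ {t | t i ≤ 1}) ∩
      ({t | t 0 + t 1 + t 2 ≤ 2} ∩ ({t | |t 1 - t 2| ≤ t 0} ∩ {t | t 0 ≤ t 1 + t 2})) := by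
    ext t
    simp [trinionPolytope]
  rw [h]
  refine (isClosed_iInter fun i => (isClosed_le ?_ ?_).inter (isClosed_le ?_ ?_)).inter
    ((isClosed_le ?_ ?_).inter ((isClosed_le ?_ ?_).inter (isClosed_le ?_ ?_))) <;> fun_prop

/-- A linear form with odd coefficients in three (not necessarily distinct) coordinates takes each
value on a null set only. -/
theorem ae_sum_trinionSign_ne {ι : Type*} [Fintype ι] (c : Fin 3 → ι) (k : Fin 4) (a : ℝ) :
    ∀ᵐ t : ι → ℝ, ∑ j, (trinionSign k j : ℝ) * t (c j) ≠ a := by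
  classical
  let φ : (ι → ℝ) →ₗ[ℝ] ℝ := ∑ j, (trinionSign k j : ℝ) • LinearMap.proj (c j)
  have hφ : ∀ t, φ t = ∑ j, (trinionSign k j : ℝ) * t (c j) := fun t => by simp [φ]
  -- At the constant vector the value is `1` or `3`, however many of the `c j` coincide.
  have h1 : φ (fun _ => 1) ≠ 0 := by
    rw [hφ]
    fin_cases k <;> norm_num [Fin.sum_univ_three, trinionSign, Fin.ext_iff]
  have hnull := MeasureTheory.Measure.addHaar_affineSubspace MeasureTheory.volume
    ((AffineSubspace.mk' a (⊥ : Submodule ℝ ℝ)).comap φ.toAffineMap) ?_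
  · rw [MeasureTheory.ae_iff]
    convert! hnull using 2
    ext t
    simp [hφ, sub_eq_zero]
  · intro htop
    have m0 : ∀ t, φ t = a := by
      intro t
      have : t ∈ ((AffineSubspace.mk' a (⊥ : Submodule ℝ ℝ)).comap φ.toAffineMap) := by
        rw [htop]; trivial
      simpa [sub_eq_zero] using this
    exact h1 ((m0 _).trans ((m0 0).symm.trans (map_zero φ)))

/-! ### Integrals of products of sines against the Migdal weight -/

/-- The function `t ↦ sin ((n + 1) π t)`. -/
noncomputable def sinMode (n : ℕ) (t : ℝ) : ℝ := Real.sin (((n : ℝ) + 1) * (Real.pi * t))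

theorem continuous_sinMode (n : ℕ) : Continuous (sinMode n) := by
  unfold sinMode
  fun_prop

theorem abs_sinMode_le (n : ℕ) (t : ℝ) : |sinMode n t| ≤ 1 := Real.abs_sin_le_one _

/-- Lebesgue measure on the unit interval. -/
noncomputable abbrev unitVolume : MeasureTheory.Measure ℝ :=
  MeasureTheory.volume.restrict (Set.Icc 0 1)

theorem integral_unitVolume (f : ℝ → ℝ) : ∫ t, f t ∂unitVolume = ∫ t in (0 : ℝ)..1, f t := by
  rw [intervalIntegral.integral_of_le zero_le_one, MeasureTheory.integral_Icc_eq_integral_Ioc]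

theorem integrable_unitVolume {f : ℝ → ℝ} (hf : Continuous f) :
    MeasureTheory.Integrable f unitVolume :=
  hf.continuousOn.integrableOn_compact isCompact_Icc

theorem integral_cos_int_mul_pi (k : ℤ) :
    ∫ t in (0 : ℝ)..1, Real.cos ((k * Real.pi) * t) = if k = 0 then 1 else 0 := by
  split_ifs with h
  · simp [h]
  · have hk : (k : ℝ) * Real.pi ≠ 0 := mul_ne_zero (by exact_mod_cast h) Real.pi_ne_zero
    rw [intervalIntegral.integral_comp_mul_left _ hk, integral_cos]
    simp [Real.sin_int_mul_pi]

theorem integral_sinMode_mul_sinMode (n m : ℕ) :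
    ∫ t, sinMode n t * sinMode m t ∂unitVolume = if n = m then 1 / 2 else 0 := by
  have h : ∀ t, sinMode n t * sinMode m t =
      (Real.cos ((((n : ℤ) - m : ℤ) * Real.pi) * t)
        - Real.cos ((((n : ℤ) + m + 2 : ℤ) * Real.pi) * t)) / 2 := by
    intro t
    have e1 : (((n : ℤ) - m : ℤ) * Real.pi) * t
        = ((n : ℝ) + 1) * (Real.pi * t) - ((m : ℝ) + 1) * (Real.pi * t) := by push_cast; ring
    have e2 : (((n : ℤ) + m + 2 : ℤ) * Real.pi) * t
        = ((n : ℝ) + 1) * (Real.pi * t) + ((m : ℝ) + 1) * (Real.pi * t) := by push_cast; ring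
    rw [e1, e2, Real.cos_sub, Real.cos_add, sinMode, sinMode]
    ring
  simp only [h, integral_unitVolume]
  rw [intervalIntegral.integral_div, intervalIntegral.integral_sub, integral_cos_int_mul_pi,
    integral_cos_int_mul_pi, if_neg (by omega : (n : ℤ) + m + 2 ≠ 0)]
  · by_cases hnm : n = m
    · simp [hnm]
    · rw [if_neg (by omega), if_neg hnm]; simp
  all_goals
    exact Continuous.intervalIntegrable (by fun_prop) _ _

theorem altSum_eq_sum_range (a k : ℕ) (f : ℕ → ℝ) :
    altSum a (a + 2 * k) f = ∑ i ∈ Finset.range (k + 1), f (a + 2 * i) := by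
  symm
  refine Finset.sum_bij (fun i _ => a + 2 * i) ?_ ?_ ?_ fun _ _ => rfl
  · intro i hi
    simp only [Finset.mem_range, Finset.mem_filter, Finset.mem_Icc] at hi ⊢
    exact ⟨by omega, ⟨i, by omega⟩⟩
  · intro i _ j _ h
    omega
  · intro l hl
    simp only [Finset.mem_filter, Finset.mem_Icc] at hl
    obtain ⟨h1, r, hr⟩ := hl
    exact ⟨r, Finset.mem_range.2 (by omega), by omega⟩

theorem altSum_natAbs_of_le {n m : ℕ} (h : m ≤ n) (f : ℕ → ℝ) :
    altSum ((n : ℤ) - (m : ℤ)).natAbs (n + m) f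
      = ∑ i ∈ Finset.range (m + 1), f (n - m + 2 * i) := by
  rw [← altSum_eq_sum_range]
  congr 1 <;> omega

theorem altSum_natAbs_comm (n m : ℕ) (f : ℕ → ℝ) :
    altSum ((n : ℤ) - (m : ℤ)).natAbs (n + m) f = altSum ((m : ℤ) - (n : ℤ)).natAbs (m + n) f := by
  congr 1 <;> omega

theorem two_mul_sinMode_mul_sinMode_zero (l : ℕ) (t : ℝ) :
    2 * (sinMode l t * sinMode 0 t)
      = Real.cos (l * (Real.pi * t)) - Real.cos (((l + 2 : ℕ) : ℝ) * (Real.pi * t)) := by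
  have e1 : (l : ℝ) * (Real.pi * t) = ((l : ℝ) + 1) * (Real.pi * t) - Real.pi * t := by ring
  have e2 : ((l + 2 : ℕ) : ℝ) * (Real.pi * t) = ((l : ℝ) + 1) * (Real.pi * t) + Real.pi * t := by
    push_cast; ring
  rw [e1, e2, Real.cos_sub, Real.cos_add, sinMode, sinMode]
  simp only [Nat.cast_zero, zero_add, one_mul]
  ring

/-- The Clebsch–Gordan formula for characters of `SU(2)`, multiplied by a square of a sine. -/
theorem sinMode_mul_sinMode (n m : ℕ) (t : ℝ) :
    sinMode n t * sinMode m t = sinMode 0 t *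
      altSum ((n : ℤ) - (m : ℤ)).natAbs (n + m) fun l => sinMode l t := by
  wlog h : m ≤ n generalizing n m
  · rw [mul_comm, altSum_natAbs_comm]
    exact this m n (by omega)
  rw [altSum_natAbs_of_le h]
  -- With `u = πt`, `2 sin((l+1)u) sin u = cos(lu) - cos((l+2)u)`, which telescopes in steps of `2`.
  have tel : ∀ k : ℕ, 2 * (sinMode 0 t * ∑ i ∈ Finset.range k, sinMode (n - m + 2 * i) t)
      = Real.cos ((n - m : ℕ) * (Real.pi * t))
        - Real.cos ((n - m + 2 * k : ℕ) * (Real.pi * t)) := by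
    intro k
    induction k with
    | zero => simp
    | succ k ih =>
      have h2 := two_mul_sinMode_mul_sinMode_zero (n - m + 2 * k) t
      rw [Finset.sum_range_succ, mul_add, mul_add, ih, mul_comm (sinMode 0 t), h2]
      rw [show n - m + 2 * (k + 1) = n - m + 2 * k + 2 by ring]
      ring
  have h1 := tel (m + 1)
  rw [show n - m + 2 * (m + 1) = n + m + 2 by omega] at h1
  have e1 : ((n - m : ℕ) : ℝ) * (Real.pi * t)
      = ((n : ℝ) + 1) * (Real.pi * t) - ((m : ℝ) + 1) * (Real.pi * t) := by
    rw [Nat.cast_sub h]; ring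
  have e2 : ((n + m + 2 : ℕ) : ℝ) * (Real.pi * t)
      = ((n : ℝ) + 1) * (Real.pi * t) + ((m : ℝ) + 1) * (Real.pi * t) := by push_cast; ring
  rw [e1, e2, Real.cos_sub, Real.cos_add] at h1
  simp only [sinMode] at h1 ⊢
  linarith

/-! ### The Migdal weight -/

theorem migdalCoeff_pos (β : ℝ) (l : ℕ) : 0 < migdalCoeff β l :=
  mul_pos (Real.exp_pos _) (by positivity)

theorem migdalEdgeFactor_pos (β : ℝ) (n m : ℕ) : 0 < migdalEdgeFactor β n m := by
  unfold migdalEdgeFactor altSum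
  refine Finset.sum_pos (fun l _ => migdalCoeff_pos β l) ⟨((n : ℤ) - (m : ℤ)).natAbs, ?_⟩
  simp only [Finset.mem_filter, Finset.mem_Icc, Nat.sub_self]
  exact ⟨by omega, Even.zero⟩

theorem charHat_mul_sin (l : ℕ) (t : ℝ) :
    charHat l (Real.pi * t) * sinMode 0 t = sinMode l t := by
  simp [charHat, sinMode]

theorem continuous_charHat (l : ℕ) : Continuous (charHat l) := by
  unfold charHat
  fun_prop

/-- Induction on `U_{l+1} = X U_l + T_{l+1}`, which also covers the zeros of the sine. -/
theorem abs_charHat_le (l : ℕ) (u : ℝ) : |charHat l u| ≤ l + 1 := by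
  induction l with
  | zero => simp [charHat]
  | succ l ih =>
    have h : charHat (l + 1) u
        = Real.cos u * charHat l u + Real.cos (((l : ℝ) + 1) * u) := by
      have := Polynomial.Chebyshev.T_real_cos u ((l : ℤ) + 1)
      push_cast at this
      rw [charHat, charHat, Nat.cast_add_one, Polynomial.Chebyshev.U_eq_X_mul_U_add_T,
        Polynomial.eval_add, Polynomial.eval_mul, Polynomial.eval_X, this]
    rw [h]
    calc _ ≤ |Real.cos u * charHat l u| + |Real.cos (((l : ℝ) + 1) * u)| := abs_add_le _ _
      _ ≤ 1 * ((l : ℝ) + 1) + 1 := by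
        rw [abs_mul]
        gcongr
        · exact Real.abs_cos_le_one _
        · exact Real.abs_cos_le_one _
      _ = _ := by push_cast; ring

theorem summable_migdalCoeff_mul {β : ℝ} (hβ : 0 < β) :
    Summable fun l : ℕ => migdalCoeff β l * ((l : ℝ) + 1) := by
  have hr : 0 < β ^ 2 / 2 := by positivity
  have hs := (((Real.summable_pow_mul_exp_neg_nat_mul 2 hr).add
    ((Real.summable_pow_mul_exp_neg_nat_mul 1 hr).mul_left 2)).add
    (Real.summable_pow_mul_exp_neg_nat_mul 0 hr))
  refine Summable.of_nonneg_of_le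
    (fun l => mul_nonneg (migdalCoeff_pos β l).le (by positivity)) (fun l => ?_) hs
  have he : Real.exp (-((l : ℝ) * (l + 1) * β ^ 2 / 2)) ≤ Real.exp (-(β ^ 2 / 2) * l) := by
    apply Real.exp_le_exp.2
    have : 0 ≤ (l : ℝ) * l * (β ^ 2 / 2) := by positivity
    linarith
  calc migdalCoeff β l * ((l : ℝ) + 1)
      = Real.exp (-((l : ℝ) * (l + 1) * β ^ 2 / 2)) * ((l : ℝ) + 1) ^ 2 := by
        rw [migdalCoeff]; ring
    _ ≤ Real.exp (-(β ^ 2 / 2) * l) * ((l : ℝ) + 1) ^ 2 := by gcongr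
    _ = _ := by ring

theorem summable_migdalCoeff {β : ℝ} (hβ : 0 < β) : Summable (migdalCoeff β) := by
  refine Summable.of_nonneg_of_le (fun l => (migdalCoeff_pos β l).le) (fun l => ?_)
    (summable_migdalCoeff_mul hβ)
  have := migdalCoeff_pos β l
  nlinarith [Nat.cast_nonneg (α := ℝ) l]

theorem norm_migdal_summand_le (β : ℝ) (l : ℕ) (t : ℝ) :
    ‖migdalCoeff β l * charHat l (Real.pi * t)‖ ≤ migdalCoeff β l * ((l : ℝ) + 1) := by
  rw [norm_mul, Real.norm_eq_abs, Real.norm_eq_abs, abs_of_pos (migdalCoeff_pos β l)]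
  exact mul_le_mul_of_nonneg_left (abs_charHat_le l _) (migdalCoeff_pos β l).le

theorem summable_migdal {β : ℝ} (hβ : 0 < β) (t : ℝ) :
    Summable fun l : ℕ => migdalCoeff β l * charHat l (Real.pi * t) :=
  (summable_migdalCoeff_mul hβ).of_norm_bounded fun l => norm_migdal_summand_le β l t

theorem continuous_migdalWeight {β : ℝ} (hβ : 0 < β) : Continuous (migdalWeight β) :=
  continuous_tsum (fun l => continuous_const.mul ((continuous_charHat l).comp (by fun_prop)))
    (summable_migdalCoeff_mul hβ) fun l t => norm_migdal_summand_le β l t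

theorem hasSum_migdalWeight_mul_sin {β : ℝ} (hβ : 0 < β) (t : ℝ) :
    HasSum (fun l => migdalCoeff β l * sinMode l t) (migdalWeight β t * sinMode 0 t) := by
  have h := (summable_migdal hβ t).hasSum.mul_right (sinMode 0 t)
  simpa only [mul_assoc, charHat_mul_sin, migdalWeight] using h

/-- The factor `sin(πt)` clears the denominators of the characters, leaving a sine series whose
coefficients orthogonality reads off. -/
theorem integral_migdalWeight_mul_sin {β : ℝ} (hβ : 0 < β) (l : ℕ) :
    ∫ t, migdalWeight β t * sinMode 0 t * sinMode l t ∂unitVolume = migdalCoeff β l / 2 := by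
  have h : HasSum (fun k => ∫ t, migdalCoeff β k * sinMode k t * sinMode l t ∂unitVolume)
      (∫ t, migdalWeight β t * sinMode 0 t * sinMode l t ∂unitVolume) := by
    refine MeasureTheory.hasSum_integral_of_dominated_convergence
      (fun k _ => migdalCoeff β k) (fun k => ?_) (fun k => ?_) ?_ ?_ ?_
    · exact (((continuous_sinMode k).const_mul _).mul (continuous_sinMode l)).aestronglyMeasurable
    · refine Filter.Eventually.of_forall fun t => ?_
      rw [norm_mul, norm_mul, Real.norm_of_nonneg (migdalCoeff_pos β k).le, mul_assoc]
      exact mul_le_of_le_one_right (migdalCoeff_pos β k).le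
        (mul_le_one₀ (abs_sinMode_le k t) (norm_nonneg _) (abs_sinMode_le l t))
    · exact Filter.Eventually.of_forall fun t => summable_migdalCoeff hβ
    · exact MeasureTheory.integrable_const _
    · exact Filter.Eventually.of_forall fun t => (hasSum_migdalWeight_mul_sin hβ t).mul_right _
  have h' : ∀ k, ∫ t, migdalCoeff β k * sinMode k t * sinMode l t ∂unitVolume
      = if k = l then migdalCoeff β l / 2 else 0 := by
    intro k
    simp only [mul_assoc]
    rw [MeasureTheory.integral_const_mul, integral_sinMode_mul_sinMode]
    split_ifs with hk
    · rw [hk]; ring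
    · ring
  simp only [h'] at h
  exact h.unique (hasSum_ite_eq l _)

theorem integral_migdalWeight_mul_sinMode_mul_sinMode {β : ℝ} (hβ : 0 < β) (n m : ℕ) :
    ∫ t, migdalWeight β t * (sinMode n t * sinMode m t) ∂unitVolume
      = migdalEdgeFactor β n m / 2 := by
  simp only [sinMode_mul_sinMode n m, altSum, migdalEdgeFactor, Finset.mul_sum, ← mul_assoc]
  rw [MeasureTheory.integral_finsetSum, Finset.sum_div]
  · exact Finset.sum_congr rfl fun l _ => integral_migdalWeight_mul_sin hβ l
  · exact fun l _ => integrable_unitVolume (((continuous_migdalWeight hβ).mul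
      (continuous_sinMode 0)).mul (continuous_sinMode l))

/-! ### Products over the circles of the pants decomposition -/

/-- A function of the boundary circles of the four trinions of a six-holed sphere: each hole
occurs once, each added circle twice. -/
theorem SixHoledSpherePants.prod_circle {M : Type*} [CommMonoid M] (S : SixHoledSpherePants)
    (F : CubeFace ⊕ Fin 3 → M) :
    ∏ p, ∏ j, F (S.circle p j) = (∏ f, F (Sum.inl f)) * ∏ c, F (Sum.inr c) ^ 2 := by
  rw [← Fintype.prod_prod_type' fun p j => F (S.circle p j),
    ← Finset.prod_fiberwise Finset.univ (fun q : Fin 4 × Fin 3 => S.circle q.1 q.2),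
    Fintype.prod_sum_type]
  congr 1
  · refine Finset.prod_congr rfl fun f _ => ?_
    rw [Finset.prod_congr rfl fun q hq => by rw [(Finset.mem_filter.1 hq).2],
      Finset.prod_const, S.face_once, pow_one]
  · refine Finset.prod_congr rfl fun c _ => ?_
    rw [Finset.prod_congr rfl fun q hq => by rw [(Finset.mem_filter.1 hq).2],
      Finset.prod_const, S.added_twice]

/-- Equality passes across each added circle, hence along any walk between trinions. -/
theorem SixHoledSpherePants.eq_of_connected {α : Type*} (S : SixHoledSpherePants) {m : Fin 4 → α}
    (h : ∀ c p p' j j', S.circle p j = Sum.inr c → S.circle p' j' = Sum.inr c → m p = m p')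
    (p p' : Fin 4) : m p = m p' := by
  obtain ⟨w⟩ := S.connected.preconnected p p'
  induction w with
  | nil => rfl
  | cons hadj _ ih =>
    refine Eq.trans ?_ ih
    rw [SimpleGraph.fromRel_adj] at hadj
    obtain ⟨-, ⟨c, j, j', h1, h2⟩ | ⟨c, j, j', h1, h2⟩⟩ := hadj
    · exact h c _ _ j j' h1 h2
    · exact h c _ _ j' j h2 h1

/-- Every plaquette is a face of the cubes at its two ends. -/
theorem prod_facePlaquette {L : ℕ} [NeZero L] {M : Type*} [CommMonoid M]
    (F : LatticePoint L → Plaquette L → M) :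
    ∏ x, ∏ f, F x (facePlaquette x f) = ∏ e : Plaquette L, F e.v₁ e * F e.v₂ e := by
  -- Translation by `eᵢ`: the upper face of `x` is the plaquette based at `x + eᵢ`, whose first end
  -- is `x`.
  have h1 : ∀ i : Fin 3, ∏ x : LatticePoint L, F x (x + Pi.single i 1, i)
      = ∏ x : LatticePoint L, F (x - Pi.single i 1) (x, i) := by
    intro i
    refine Fintype.prod_equiv (Equiv.addRight (Pi.single i 1)) _ _ fun x => ?_
    simp
  simp only [Fintype.prod_prod_type, Fintype.prod_bool, facePlaquette, Plaquette.v₁,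
    Plaquette.v₂, if_true, Bool.false_eq_true, if_false]
  rw [Finset.prod_comm]
  conv_rhs => rw [Finset.prod_comm]
  refine Finset.prod_congr rfl fun i _ => ?_
  rw [Finset.prod_mul_distrib, Finset.prod_mul_distrib, h1]

theorem boundaryCircle_eq_inr_iff {L : ℕ} (D : LatticePoint L → SixHoledSpherePants)
    (p : Trinion L) (j : Fin 3) (x : LatticePoint L) (c : Fin 3) :
    boundaryCircle D p j = Sum.inr (x, c) ↔ p.1 = x ∧ (D x).circle p.2 j = Sum.inr c := by
  unfold boundaryCircle
  constructor
  · intro h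
    split at h
    · simp at h
    · rename_i c' hc
      obtain ⟨h1, h2⟩ := Prod.mk.inj (Sum.inr.inj h)
      subst h1 h2
      exact ⟨rfl, hc⟩
  · rintro ⟨rfl, h⟩
    rw [h]

theorem SixHoledSpherePants.filter_circle_eq (S : SixHoledSpherePants) {c : Fin 3}
    {q q' : Fin 4 × Fin 3} (hne : q ≠ q') (h : S.circle q.1 q.2 = Sum.inr c)
    (h' : S.circle q'.1 q'.2 = Sum.inr c) :
    (Finset.univ.filter fun r : Fin 4 × Fin 3 => S.circle r.1 r.2 = Sum.inr c) = {q, q'} := by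
  symm
  refine Finset.eq_of_subset_of_card_le ?_ ?_
  · intro r hr
    rw [Finset.mem_insert, Finset.mem_singleton] at hr
    rcases hr with rfl | rfl <;> simp [h, h']
  · rw [S.added_twice, Finset.card_pair hne]

/-- The product over all trinions, with index `n x` at the four trinions of the cube `x`. -/
theorem prod_boundaryCircle {L : ℕ} [NeZero L] {M : Type*} [CommMonoid M]
    (D : LatticePoint L → SixHoledSpherePants) (F : LatticePoint L → PantsCircle L → M) :
    ∏ p : Trinion L, ∏ j, F p.1 (boundaryCircle D p j)
      = (∏ e : Plaquette L, F e.v₁ (Sum.inl e) * F e.v₂ (Sum.inl e)) *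
        ∏ y : LatticePoint L × Fin 3, F y.1 (Sum.inr y) ^ 2 := by
  rw [Fintype.prod_prod_type, Fintype.prod_prod_type (f := fun y => F y.1 (Sum.inr y) ^ 2),
    ← prod_facePlaquette fun x e => F x (Sum.inl e), ← Finset.prod_mul_distrib]
  refine Finset.prod_congr rfl fun x _ => ?_
  refine Eq.trans ?_ ((D x).prod_circle fun y => F x
    (y.elim (fun f => Sum.inl (facePlaquette x f)) fun c => Sum.inr (x, c)))
  refine Finset.prod_congr rfl fun p _ => Finset.prod_congr rfl fun j _ => ?_
  unfold boundaryCircle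
  cases h : (D x).circle p j <;> simp

/-! ### Integration over the unit cube -/

/-- Lebesgue measure on the unit cube in the space of coordinates at the circles. -/
noncomputable abbrev cubeVolume (L : ℕ) [NeZero L] : MeasureTheory.Measure (PantsCircle L → ℝ) :=
  MeasureTheory.Measure.pi fun _ => unitVolume

theorem cubeVolume_eq (L : ℕ) [NeZero L] : cubeVolume L =
    MeasureTheory.volume.restrict (Set.univ.pi fun _ => Set.Icc (0 : ℝ) 1) := by
  rw [cubeVolume, MeasureTheory.volume_pi, MeasureTheory.Measure.restrict_pi_pi]

theorem integrable_cubeVolume {L : ℕ} [NeZero L] {f : (PantsCircle L → ℝ) → ℝ}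
    (hf : Continuous f) : MeasureTheory.Integrable f (cubeVolume L) := by
  rw [cubeVolume_eq]
  exact hf.continuousOn.integrableOn_compact (isCompact_univ_pi fun _ => isCompact_Icc)

/-! ### Mode integrals and the selection rule -/

/-- The integral of a product of sine modes, one for each boundary component of each trinion,
against the product of the Migdal weights. -/
noncomputable def modeIntegral {L : ℕ} [NeZero L] (D : LatticePoint L → SixHoledSpherePants)
    (β : ℝ) (m : Trinion L → ℕ) : ℝ :=
  ∫ t, (∏ p, ∏ j, sinMode (m p) (t (boundaryCircle D p j))) * migdalWeightProd β t ∂cubeVolume L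

theorem modeIntegral_comp_fst {L : ℕ} [NeZero L] (D : LatticePoint L → SixHoledSpherePants)
    {β : ℝ} (hβ : 0 < β) (n : LatticePoint L → ℕ) :
    modeIntegral D β (fun p => n p.1)
      = (∏ e : Plaquette L, migdalEdgeFactor β (n e.v₁) (n e.v₂) / 2) *
        ∏ _y : LatticePoint L × Fin 3, (1 / 2 : ℝ) := by
  have h : ∀ t : PantsCircle L → ℝ,
      (∏ p : Trinion L, ∏ j, sinMode (n p.1) (t (boundaryCircle D p j))) * migdalWeightProd β t
      = ∏ γ, (Sum.elim
          (fun e s => migdalWeight β s * (sinMode (n e.v₁) s * sinMode (n e.v₂) s))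
          (fun y s => sinMode (n y.1) s * sinMode (n y.1) s) : PantsCircle L → ℝ → ℝ) γ (t γ) := by
    intro t
    rw [prod_boundaryCircle D (fun x γ => sinMode (n x) (t γ)), Fintype.prod_sum_type,
      migdalWeightProd]
    simp only [Sum.elim_inl, Sum.elim_inr, pow_two, Finset.prod_mul_distrib]
    ring
  unfold modeIntegral
  simp only [h]
  rw [MeasureTheory.integral_fintype_prod_eq_prod, Fintype.prod_sum_type]
  simp only [Sum.elim_inl, Sum.elim_inr, integral_migdalWeight_mul_sinMode_mul_sinMode hβ,
    integral_sinMode_mul_sinMode, if_true]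

/-- The integrand factors over the circles. The circle `(x, c)` carries no weight and exactly two
sines, here of different frequencies, so its factor integrates to zero. -/
theorem modeIntegral_eq_zero {L : ℕ} [NeZero L] (D : LatticePoint L → SixHoledSpherePants)
    (β : ℝ) {m : Trinion L → ℕ} {x : LatticePoint L} {c : Fin 3} {p p' : Fin 4} {j j' : Fin 3}
    (h : (D x).circle p j = Sum.inr c) (h' : (D x).circle p' j' = Sum.inr c)
    (hne : m (x, p) ≠ m (x, p')) : modeIntegral D β m = 0 := by
  classical
  let g : PantsCircle L → ℝ → ℝ := fun γ s =>
    (∏ q : Trinion L × Fin 3 with boundaryCircle D q.1 q.2 = γ, sinMode (m q.1) s) *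
      Sum.elim (fun _ => migdalWeight β s) (fun _ => 1) γ
  have hfac : ∀ t : PantsCircle L → ℝ,
      (∏ p : Trinion L, ∏ j, sinMode (m p) (t (boundaryCircle D p j))) * migdalWeightProd β t
      = ∏ γ, g γ (t γ) := by
    intro t
    simp only [g]
    rw [Finset.prod_mul_distrib, Fintype.prod_sum_type
      (fun γ : PantsCircle L => Sum.elim (fun _ => migdalWeight β (t γ)) (fun _ => 1) γ)]
    simp only [Sum.elim_inl, Sum.elim_inr, Finset.prod_const_one, mul_one]
    rw [← Fintype.prod_prod_type' fun p j => sinMode (m p) (t (boundaryCircle D p j)),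
      ← Finset.prod_fiberwise Finset.univ
        (fun q : Trinion L × Fin 3 => boundaryCircle D q.1 q.2), migdalWeightProd]
    congr 1
    exact Finset.prod_congr rfl fun γ _ => Finset.prod_congr rfl fun q hq => by
      rw [(Finset.mem_filter.1 hq).2]
  have hpp : (p, j) ≠ (p', j') := fun he => hne (by rw [(Prod.mk.inj he).1])
  have hfib : (Finset.univ.filter fun q : Trinion L × Fin 3 =>
      boundaryCircle D q.1 q.2 = Sum.inr (x, c)) = {((x, p), j), ((x, p'), j')} := by
    have hloc := (D x).filter_circle_eq hpp h h'
    ext ⟨⟨y, r⟩, k⟩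
    have hr := Finset.ext_iff.1 hloc (r, k)
    simp only [Finset.mem_filter, Finset.mem_univ, true_and, Finset.mem_insert,
      Finset.mem_singleton, boundaryCircle_eq_inr_iff, Prod.mk.injEq] at hr ⊢
    rw [hr]
    tauto
  unfold modeIntegral
  rw [MeasureTheory.integral_congr_ae (Filter.Eventually.of_forall hfac),
    MeasureTheory.integral_fintype_prod_eq_prod g]
  refine Finset.prod_eq_zero (Finset.mem_univ (Sum.inr (x, c))) ?_
  have hpp' : ((x, p), j) ≠ ((x, p'), j') := fun he => hpp (by simpa using he)
  simp only [g, hfib, Finset.prod_pair hpp', Sum.elim_inr, mul_one, integral_sinMode_mul_sinMode,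
    if_neg hne]

theorem continuous_migdalWeightProd {L : ℕ} [NeZero L] {β : ℝ} (hβ : 0 < β) :
    Continuous (migdalWeightProd (L := L) β) :=
  continuous_finsetProd _ fun e _ =>
    (continuous_migdalWeight hβ).comp (continuous_apply (Sum.inl e))

/-- Each cube has four trinions, three added circles and, on average, three plaquettes; the constant
is `4⁴ · 2⁻³ · 2⁻³ = 4 = (√2)⁴`. -/
theorem prod_const_mul_modeIntegral_comp_fst {L : ℕ} [NeZero L]
    (D : LatticePoint L → SixHoledSpherePants) {β : ℝ} (hβ : 0 < β) (n : LatticePoint L → ℕ) :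
    (∏ p : Trinion L, 4 / (Real.pi * ((n p.1 : ℝ) + 1))) * modeIntegral D β (fun p => n p.1)
      = migdalTerm β n := by
  rw [modeIntegral_comp_fst D hβ, migdalTerm]
  simp only [div_eq_mul_inv (migdalEdgeFactor _ _ _), Finset.prod_mul_distrib]
  rw [mul_comm (∏ e : Plaquette L, migdalEdgeFactor β (n e.v₁) (n e.v₂)), mul_assoc, mul_comm _
    (∏ _y : LatticePoint L × Fin 3, (1 / 2 : ℝ)), ← mul_assoc, ← mul_assoc]
  congr 1
  rw [Fintype.prod_prod_type, Fintype.prod_prod_type, Fintype.prod_prod_type,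
    ← Finset.prod_mul_distrib, ← Finset.prod_mul_distrib]
  refine Finset.prod_congr rfl fun x _ => ?_
  have hn : (n x : ℝ) + 1 ≠ 0 := by positivity
  have hpi := Real.pi_ne_zero
  have h4 : Real.sqrt 2 ^ 4 = 4 := by
    rw [show (4 : ℕ) = 2 * 2 by rfl, pow_mul, Real.sq_sqrt (by norm_num)]; norm_num
  simp only [Finset.prod_const, Finset.card_univ, Fintype.card_fin, div_pow, h4]
  field_simp
  norm_num

/-- The integral over the unit cube in which the indicator functions of the trinion polytopes are
replaced by the partial sums of their expansions. -/
theorem integral_prod_trinionSum {L : ℕ} [NeZero L] (D : LatticePoint L → SixHoledSpherePants)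
    {β : ℝ} (hβ : 0 < β) (N : ℕ) :
    ∫ t, (∏ p : Trinion L, trinionSum N fun j => t (boundaryCircle D p j)) *
        migdalWeightProd β t ∂cubeVolume L
      = ∑ n ∈ Fintype.piFinset fun _ : LatticePoint L => Finset.range N, migdalTerm β n := by
  have h : ∀ t : PantsCircle L → ℝ,
      (∏ p : Trinion L, trinionSum N fun j => t (boundaryCircle D p j)) * migdalWeightProd β t
      = ∑ m ∈ Fintype.piFinset fun _ : Trinion L => Finset.range N,
          (∏ p, 4 / (Real.pi * ((m p : ℝ) + 1))) *
            ((∏ p, ∏ j, sinMode (m p) (t (boundaryCircle D p j))) * migdalWeightProd β t) := by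
    intro t
    simp only [trinionSum]
    rw [Finset.prod_univ_sum, Finset.sum_mul]
    refine Finset.sum_congr rfl fun m _ => ?_
    rw [Finset.prod_mul_distrib, mul_assoc]
    rfl
  simp only [h]
  rw [MeasureTheory.integral_finsetSum]
  · simp only [MeasureTheory.integral_const_mul]
    symm
    -- Box indices on cubes embed as the indices constant on each cube. Any other index differs
    -- across some added circle, so its term vanishes.
    refine Finset.sum_of_injOn (fun n p => n p.1) ?_ ?_ ?_ ?_
    · intro n _ n' _ hnn
      funext x
      exact congrFun hnn (x, 0)
    · intro n hn
      simp only [Finset.mem_coe, Fintype.mem_piFinset] at hn ⊢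
      exact fun p => hn p.1
    · intro m hm hm'
      by_cases hc : ∀ x c p p' j j', (D x).circle p j = Sum.inr c →
          (D x).circle p' j' = Sum.inr c → m (x, p) = m (x, p')
      · refine absurd ⟨fun x => m (x, 0), ?_, ?_⟩ hm'
        · simp only [Finset.mem_coe, Fintype.mem_piFinset] at hm ⊢
          exact fun x => hm (x, 0)
        · funext p
          exact (D p.1).eq_of_connected (m := fun r => m (p.1, r)) (hc p.1) 0 p.2
      · push Not at hc
        obtain ⟨x, c, p, p', j, j', h1, h2, h3⟩ := hc
        exact mul_eq_zero_of_right _ (modeIntegral_eq_zero D β h1 h2 h3)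
    · exact fun n _ => (prod_const_mul_modeIntegral_comp_fst D hβ n).symm
  · intro m _
    refine (integrable_cubeVolume (Continuous.mul ?_ (continuous_migdalWeightProd hβ))).const_mul _
    exact continuous_finsetProd _ fun p _ => continuous_finsetProd _ fun j _ =>
      (continuous_sinMode _).comp (continuous_apply _)

/-! ### The pants polytope -/

theorem exists_boundaryCircle_eq {L : ℕ} (D : LatticePoint L → SixHoledSpherePants)
    (γ : PantsCircle L) : ∃ p j, boundaryCircle D p j = γ := by
  rcases γ with ⟨x, i⟩ | ⟨x, c⟩
  · obtain ⟨q, hq⟩ := Finset.card_pos.1 (((D x).face_once (i, false)).symm ▸ Nat.one_pos)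
    refine ⟨(x, q.1), q.2, ?_⟩
    rw [boundaryCircle, (Finset.mem_filter.1 hq).2]
    simp [facePlaquette]
  · obtain ⟨q, hq⟩ := Finset.card_pos.1 (((D x).added_twice c).symm ▸ Nat.two_pos)
    refine ⟨(x, q.1), q.2, ?_⟩
    rw [boundaryCircle, (Finset.mem_filter.1 hq).2]

theorem pantsPolytope_subset {L : ℕ} (D : LatticePoint L → SixHoledSpherePants) :
    pantsPolytope D ⊆ Set.univ.pi fun _ => Set.Icc (0 : ℝ) 1 := by
  intro t ht γ _
  obtain ⟨p, j, rfl⟩ := exists_boundaryCircle_eq D γ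
  exact (ht p).1 j

theorem isClosed_pantsPolytope {L : ℕ} (D : LatticePoint L → SixHoledSpherePants) :
    IsClosed (pantsPolytope D) := by
  have h : pantsPolytope D = ⋂ p : Trinion L,
      (fun t j => t (boundaryCircle D p j)) ⁻¹' trinionPolytope := by
    ext t
    simp [pantsPolytope]
  rw [h]
  exact isClosed_iInter fun p => isClosed_trinionPolytope.preimage (by fun_prop)

theorem isCompact_pantsPolytope {L : ℕ} (D : LatticePoint L → SixHoledSpherePants) :
    IsCompact (pantsPolytope D) :=
  (isCompact_univ_pi fun _ => isCompact_Icc).of_isClosed_subset (isClosed_pantsPolytope D)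
    (pantsPolytope_subset D)

theorem indicator_pantsPolytope {L : ℕ} [NeZero L] (D : LatticePoint L → SixHoledSpherePants)
    (F t) : (pantsPolytope D).indicator F t =
      (∏ p : Trinion L, trinionPolytope.indicator (fun _ => (1 : ℝ))
        fun j => t (boundaryCircle D p j)) * F t := by
  by_cases h : t ∈ pantsPolytope D
  · rw [Set.indicator_of_mem h, Finset.prod_eq_one fun p _ => Set.indicator_of_mem (h p) _, one_mul]
  · rw [Set.indicator_of_notMem h]
    simp only [pantsPolytope, Set.mem_ofPred_eq, not_forall] at h
    obtain ⟨p, hp⟩ := h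
    rw [Finset.prod_eq_zero (Finset.mem_univ p) (Set.indicator_of_notMem hp _), zero_mul]

theorem integral_indicator_cubeVolume {L : ℕ} [NeZero L] (D : LatticePoint L → SixHoledSpherePants)
    (F : (PantsCircle L → ℝ) → ℝ) :
    ∫ t, (pantsPolytope D).indicator F t ∂cubeVolume L = ∫ t in pantsPolytope D, F t := by
  rw [MeasureTheory.integral_indicator (isClosed_pantsPolytope D).measurableSet, cubeVolume_eq,
    MeasureTheory.Measure.restrict_restrict (isClosed_pantsPolytope D).measurableSet,
    Set.inter_eq_left.2 (pantsPolytope_subset D)]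

/-! ### Passage to the limit in the truncated integrals -/

theorem ae_tendsto_trinionSum {L : ℕ} [NeZero L] (D : LatticePoint L → SixHoledSpherePants) :
    ∀ᵐ t ∂cubeVolume L, ∀ p : Trinion L,
      Filter.Tendsto (fun N => trinionSum N fun j => t (boundaryCircle D p j)) Filter.atTop
        (nhds (trinionPolytope.indicator (fun _ => 1) fun j => t (boundaryCircle D p j))) := by
  have hgen : ∀ᵐ t : PantsCircle L → ℝ, ∀ (p : Trinion L) (k : Fin 4), ∀ i ∈ ({0, 2} : Set ℝ),
      ∑ j, (trinionSign k j : ℝ) * t (boundaryCircle D p j) ≠ i := by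
    refine MeasureTheory.ae_all_iff.2 fun p => MeasureTheory.ae_all_iff.2 fun k => ?_
    refine (MeasureTheory.ae_ball_iff (Set.toFinite _).countable).2 fun i _ => ?_
    exact ae_sum_trinionSign_ne (boundaryCircle D p) k i
  rw [cubeVolume_eq]
  filter_upwards [MeasureTheory.ae_restrict_of_ae hgen, MeasureTheory.ae_restrict_mem
    (MeasurableSet.univ_pi fun _ => measurableSet_Icc)] with t h1 h2 p
  exact tendsto_trinionSum (fun j => h2 _ (Set.mem_univ _)) (h1 p)

theorem tendsto_integral_prod_trinionSum {L : ℕ} [NeZero L]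
    (D : LatticePoint L → SixHoledSpherePants) {β : ℝ} (hβ : 0 < β) :
    Filter.Tendsto (fun N => ∫ t, (∏ p : Trinion L, trinionSum N fun j =>
        t (boundaryCircle D p j)) * migdalWeightProd β t ∂cubeVolume L) Filter.atTop
      (nhds (symplecticPartitionMigdal D β)) := by
  rw [symplecticPartitionMigdal, ← integral_indicator_cubeVolume]
  refine MeasureTheory.tendsto_integral_of_dominated_convergence
    (fun t => (∏ _p : Trinion L, 4 * (Real.pi / 2 + 2) / Real.pi) * ‖migdalWeightProd β t‖)
    (fun N => ?_) ?_ (fun N => ?_) ?_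
  · refine Measurable.aestronglyMeasurable (Measurable.mul ?_
      (continuous_migdalWeightProd hβ).measurable)
    exact Finset.measurable_prod _ fun p _ => (measurable_trinionSum N).comp (by fun_prop)
  · exact (integrable_cubeVolume (continuous_migdalWeightProd hβ)).norm.const_mul _
  · refine Filter.Eventually.of_forall fun t => ?_
    rw [norm_mul, norm_prod]
    gcongr
    exact abs_trinionSum_le N _
  · filter_upwards [ae_tendsto_trinionSum D] with t ht
    rw [indicator_pantsPolytope]
    exact (tendsto_finsetProd _ fun p _ => ht p).mul_const _

/-! ### Positivity and summation over boxes -/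

theorem migdalTerm_pos {L : ℕ} [NeZero L] (β : ℝ) (n : LatticePoint L → ℕ) : 0 < migdalTerm β n :=
  mul_pos (Finset.prod_pos fun v _ => by have := Real.pi_pos; positivity)
    (Finset.prod_pos fun e _ => migdalEdgeFactor_pos β _ _)

/-- A series of nonnegative terms converges as soon as its partial sums over boxes do. -/
theorem hasSum_of_tendsto_sum_piFinset_range {ι : Type*} [Fintype ι] [DecidableEq ι]
    {f : (ι → ℕ) → ℝ} (hf : ∀ n, 0 ≤ f n) {a : ℝ}
    (h : Filter.Tendsto (fun N => ∑ n ∈ Fintype.piFinset fun _ : ι => Finset.range N, f n)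
      Filter.atTop (nhds a)) : HasSum f a := by
  have hmono : Monotone fun N : ℕ => Fintype.piFinset fun _ : ι => Finset.range N :=
    fun M N hMN => Fintype.piFinset_subset _ _ fun _ => Finset.range_mono hMN
  have hbox : Filter.Tendsto (fun N : ℕ => Fintype.piFinset fun _ : ι => Finset.range N)
      Filter.atTop Filter.atTop := by
    refine Filter.tendsto_atTop_finset_of_monotone hmono fun n => ?_
    -- The sum of the coordinates bounds each of them; `+ 1` because `range` is strict.
    refine ⟨(∑ i, n i) + 1, ?_⟩
    rw [Fintype.mem_piFinset]
    exact fun i => Finset.mem_range.2 (Nat.lt_succ_of_le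
      (Finset.single_le_sum (fun _ _ => Nat.zero_le _) (Finset.mem_univ i)))
  have hsum : Summable f := by
    refine summable_of_sum_le hf (c := a) fun s => ?_
    obtain ⟨N, hN⟩ := (hbox.eventually (Filter.eventually_ge_atTop s)).exists
    refine (Finset.sum_le_sum_of_subset_of_nonneg hN fun n _ _ => hf n).trans ?_
    refine Monotone.ge_of_tendsto (fun M N hMN => ?_) h N
    exact Finset.sum_le_sum_of_subset_of_nonneg (hmono hMN) fun n _ _ => hf n
  have := tendsto_nhds_unique h (hsum.hasSum.comp hbox)
  exact this ▸ hsum.hasSum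

theorem mainTheorem4 (L : ℕ) [NeZero L] (D : LatticePoint L → SixHoledSpherePants)
    (β : ℝ) (hβ : 0 < β) :
    (∀ t : ℝ, Summable fun l : ℕ => migdalCoeff β l * charHat l (Real.pi * t)) ∧
    MeasureTheory.IntegrableOn (migdalWeightProd (L := L) β) (pantsPolytope D) ∧
    (∀ n : LatticePoint L → ℕ, 0 < migdalTerm β n) ∧
    HasSum (fun n : LatticePoint L → ℕ => migdalTerm β n) (symplecticPartitionMigdal D β) := by
  refine ⟨summable_migdal hβ, ?_, migdalTerm_pos β, ?_⟩
  · exact (continuous_migdalWeightProd hβ).continuousOn.integrableOn_compact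
      (isCompact_pantsPolytope D)
  · refine hasSum_of_tendsto_sum_piFinset_range (fun n => (migdalTerm_pos β n).le) ?_
    simp only [← integral_prod_trinionSum D hβ]
    exact tendsto_integral_prod_trinionSum D hβ
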